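/- Let $E$ be a real locally convex Hausdorff space. Say that $E$ has the metric convex compactness property if the closed convex hull of every compact metrizable subset of $E$ is compact. Then $E$ has the metric convex compactness property if and only if the following holds. Let $X$ be a topological space and let $\nu$ be a positive Borel measure on $X$ that is metrically regular, i.e. $\nu(B)=\sup\{\nu(K): K\subset B,\ K \text{ compact and metrizable}\}$ for every Borel set $B\subset X$. Let $D\subset E$ be a bounded closed absolutely convex set with gauge functional $\varphi_D:E\to[0,\infty]$, $\varphi_D(x)=\inf\{r\ge 0: x\in rD\}$ (with $\inf\emptyset=\infty$). Let $g:X\to E$ be $\nu$-Lusin-measurable, i.e. $\nu(B)=\sup\{\nu(K):K\subset B \text{ compact},\ g|_K \text{ continuous}\}$ for every Borel set $B\subset X$, and suppose that $\varphi_D\circ g$ is $\nu$-measurable (this is automatic if $\nu$ is $\sigma$-finite) with $\int_X\varphi_D\circ g\,d\nu<\infty$. Then $g$ is $\nu$-Pettis integrable, i.e. $e'\circ g$ is $\nu$-integrable for every $e'$ in the topological dual $E'$, and there is $e\in E$ with $\langle e',e\rangle=\int_X\langle e',g\rangle\,d\nu$ for all $e'\in E'$. (In both suprema $K$ ranges over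 Borel sets, which is automatic if $X$ is Hausdorff. Here $\nu$-measurable means measurable up to modification on a $\nu$-null set.) -/

import Mathlib

open MeasureTheory

universe u v

/-- The metric convex compactness property: the closed convex hull of every compact metrizable
subset of `E` is compact. -/
def MetricConvexCompact (E : Type*) [AddCommGroup E] [Module ℝ E] [TopologicalSpace E] : Prop :=
  ∀ K : Set E, IsCompact K → TopologicalSpace.MetrizableSpace K →
    IsCompact (closedConvexHull ℝ K)

/-- A Borel measure is metrically regular if `ν B = sup {ν K : K ⊆ B compact and metrizable}` for
all Borel sets `B`. Since `ν K` is meaningful only for Borel sets, the `K` are Borel sets; this is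
automatic when `X` is Hausdorff. -/
def MetricallyRegular {X : Type*} [TopologicalSpace X] [MeasurableSpace X]
    (ν : Measure X) : Prop :=
  ∀ B : Set X, MeasurableSet B →
    ν B = ⨆ (K : Set X) (_ : K ⊆ B) (_ : MeasurableSet K) (_ : IsCompact K)
      (_ : TopologicalSpace.MetrizableSpace K), ν K

/-- A function is Lusin-measurable for `ν` if `ν B = sup {ν K : K ⊆ B compact, g|K continuous}`
for all Borel sets `B` (as above, `K` ranges over Borel sets). -/
def LusinMeasurable {X E : Type*} [TopologicalSpace X] [MeasurableSpace X] [TopologicalSpace E]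
    (ν : Measure X) (g : X → E) : Prop :=
  ∀ B : Set X, MeasurableSet B →
    ν B = ⨆ (K : Set X) (_ : K ⊆ B) (_ : MeasurableSet K) (_ : IsCompact K)
      (_ : ContinuousOn g K), ν K

/-- `g` is Pettis integrable for `ν`: every continuous linear functional is integrable along `g`,
and there is an element of `E` (the Pettis integral) representing all these integrals. -/
def PettisIntegrable {X E : Type*} [MeasurableSpace X] [AddCommGroup E] [Module ℝ E]
    [TopologicalSpace E] (ν : Measure X) (g : X → E) : Prop :=
  (∀ φ : E →L[ℝ] ℝ, Integrable (fun x => φ (g x)) ν) ∧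
    ∃ e : E, ∀ φ : E →L[ℝ] ℝ, φ e = ∫ x, φ (g x) ∂ν

/-!
Let `E` have the metric convex compactness property. A function with values in a compact convex
set `C`, integrated against a finite measure, has its Pettis integral in a multiple of `C`: for
finitely many functionals this is averaging in a finite-dimensional compact convex set, and
compactness of `C` handles all functionals at once (`exists_mem_forall_eq_integral`). Regularity of
`ν` and Lusin measurability of `g` give countably many compact metrizable sets `K n` on which `g` is
continuous and outside whose union `g` vanishes almost everywhere
(`LusinMeasurable.exists_seq_cover`); here finiteness of `∫ φ_D ∘ g dν` gives the necessary
`σ`-finiteness. Made disjoint, they yield pieces on which `g` takes values in the compact metrizable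
set `g(K n)`, so each piece has a Pettis integral `e n`, and by Hahn-Banach `e n ∈ b n • D` with
`∑ b n < ∞`. It remains to sum the `e n`, although neither `E` nor `D` is complete. Choosing
`l n → ∞` with `∑ l n * b n < ∞`, the vectors `e n / (l n * b n)` tend to `0`, hence lie in a compact
metrizable set, and `∑ e n` is a Pettis integral over `ℕ` of a function with values in its closed
convex hull, which is compact (`MetricConvexCompact.exists_hasSum`).

Conversely, let `K` be compact, metrizable and nonempty. By the Hausdorff-Alexandroff theorem `K` is
the range of a continuous `f` on the Cantor space; this also allows an arbitrary universe for the
space `X`. Integrating `f` maps the compact space of probability measures onto a convex subset of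
`E` that contains `K`. Along an ultrafilter of measures the integrals converge weakly, and form a
Cauchy filter because the closed convex hull of `K` is totally bounded; so they converge in `E`
(`le_nhds_of_cauchy_of_forall_tendsto`). Thus the image is compact, and it contains the closed convex
hull of `K` (`isCompact_closedConvexHull_range_of_pettisIntegrable`).
-/

open Set Filter Topology TopologicalSpace
open scoped ENNReal Pointwise

/-! ### Metrizability of continuous images and summability -/

/-- Composition with `f` embeds `C(Y, ℝ)` isometrically in the separable space `C(X, ℝ)`; a dense
sequence in `C(Y, ℝ)` separates the points of `Y`. -/
theorem metrizableSpace_of_continuous_surjective {X Y : Type*} [TopologicalSpace X]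
    [CompactSpace X] [MetrizableSpace X] [TopologicalSpace Y] [T2Space Y] {f : X → Y}
    (hf : Continuous f) (hs : Function.Surjective f) : MetrizableSpace Y := by
  have : CompactSpace Y := hs.compactSpace hf
  let := metrizableSpaceMetric X
  let F : C(Y, ℝ) → C(X, ℝ) := fun h => h.comp ⟨f, hf⟩
  have hF : Isometry F := by
    refine Isometry.of_dist_eq fun a b => le_antisymm ?_ ?_
    · refine (ContinuousMap.dist_le dist_nonneg).2 fun x => ?_
      exact ContinuousMap.dist_apply_le_dist (f := a) (g := b) (f x)
    · refine (ContinuousMap.dist_le dist_nonneg).2 fun y => ?_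
      obtain ⟨x, rfl⟩ := hs y
      exact ContinuousMap.dist_apply_le_dist (f := F a) (g := F b) x
  have : SecondCountableTopology C(Y, ℝ) := hF.isEmbedding.secondCountableTopology
  refine Metric.PiNatEmbed.TopologicalSpace.MetrizableSpace.of_countable_separating (X := Y)
    (Y := fun _ : ℕ => ℝ)
    (fun n => denseSeq C(Y, ℝ) n) (fun n => (denseSeq C(Y, ℝ) n).continuous) fun a b hab => ?_
  obtain ⟨h, ha, hb, -⟩ := exists_continuous_zero_one_of_isClosed (isClosed_singleton (x := a))
    (isClosed_singleton (x := b)) (by simpa using hab)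
  have hne : h a ≠ h b := by
    rw [ha (mem_singleton a), hb (mem_singleton b)]; simp
  -- A function separating `a` and `b` can be perturbed to a member of the dense sequence.
  have ho : IsOpen {k : C(Y, ℝ) | k a ≠ k b} :=
    isOpen_ne_fun (continuous_eval_const a) (continuous_eval_const b)
  exact (denseRange_denseSeq C(Y, ℝ)).exists_mem_open ho ⟨h, hne⟩

theorem metrizableSpace_image {X Y : Type*} [TopologicalSpace X] [TopologicalSpace Y] [T2Space Y]
    {K : Set X} (hK : IsCompact K) (hm : MetrizableSpace K) {f : X → Y} (hf : ContinuousOn f K) :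
    MetrizableSpace (f '' K) := by
  have : CompactSpace K := isCompact_iff_compactSpace.1 hK
  refine metrizableSpace_of_continuous_surjective (X := K)
    (f := fun x => ⟨f x, mem_image_of_mem f x.2⟩) ?_ ?_
  · exact (continuousOn_iff_continuous_domRestrict.1 hf).subtype_mk _
  · rintro ⟨_, x, hx, rfl⟩
    exact ⟨⟨x, hx⟩, rfl⟩

theorem metrizableSpace_insert_range {Y : Type*} [TopologicalSpace Y] [T2Space Y] {y : ℕ → Y}
    {a : Y} (h : Tendsto y atTop (𝓝 a)) : MetrizableSpace (insert a (range y) : Set Y) := by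
  have hr : (insert a (range y) : Set Y) = OnePoint.continuousMapMkNat y a h '' univ := by
    ext z
    have h0 : OnePoint.continuousMapMkNat y a h OnePoint.infty = a := rfl
    have h1 (n : ℕ) : OnePoint.continuousMapMkNat y a h n = y n := rfl
    simp [OnePoint.exists, h0, h1, eq_comm]
  rw [hr]
  exact metrizableSpace_image isCompact_univ inferInstance (ContinuousMap.continuous _).continuousOn

/-- The weights `l n` are the reciprocals of the square roots of the tails `∑' k, b (k + n)`. -/
theorem exists_tendsto_atTop_summable_mul {b : ℕ → ℝ} (hb : ∀ n, 0 < b n) (hs : Summable b) :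
    ∃ l : ℕ → ℝ, (∀ n, 0 < l n) ∧ Tendsto l atTop atTop ∧ Summable fun n => l n * b n := by
  let t : ℕ → ℝ := fun n => ∑' k, b (k + n)
  have hsn (n : ℕ) : Summable fun k => b (k + n) := (summable_nat_add_iff n).2 hs
  have ht (n : ℕ) : 0 < t n := (hsn n).tsum_pos (fun k => (hb _).le) 0 (hb _)
  have hst (n : ℕ) : t n = b n + t (n + 1) := by
    have := (hsn n).tsum_eq_zero_add
    simp only [zero_add] at this
    simp only [t, this]
    congr 1
    exact tsum_congr fun k => by congr 1; ring
  have ht0 : Tendsto t atTop (𝓝 0) := tendsto_sum_nat_add b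
  refine ⟨fun n => (√(t n))⁻¹, fun n => inv_pos.2 (Real.sqrt_pos.2 (ht n)), ?_, ?_⟩
  · refine Tendsto.inv_tendsto_nhdsGT_zero (tendsto_nhdsWithin_iff.2 ⟨?_, ?_⟩)
    · simpa using ht0.sqrt
    · exact Eventually.of_forall fun n => Real.sqrt_pos.2 (ht n)
  · -- `b n = t n - t (n + 1)` and `b n / √(t n) ≤ 2 (√(t n) - √(t (n + 1)))` telescopes.
    have key (n : ℕ) : (√(t n))⁻¹ * b n ≤ 2 * (√(t n) - √(t (n + 1))) := by
      have h1 := Real.sqrt_pos.2 (ht n)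
      have h2 := Real.sqrt_nonneg (t (n + 1))
      have h3 := Real.mul_self_sqrt (ht n).le
      have h4 := Real.mul_self_sqrt (ht (n + 1)).le
      have h5 : √(t (n + 1)) ≤ √(t n) := Real.sqrt_le_sqrt (by linarith [hst n, hb n])
      rw [inv_mul_le_iff₀ h1]
      nlinarith [hst n]
    refine summable_of_sum_range_le (c := 2 * √(t 0))
      (fun n => mul_nonneg (inv_nonneg.2 (Real.sqrt_nonneg _)) (hb n).le) fun n => ?_
    calc ∑ i ∈ Finset.range n, (√(t i))⁻¹ * b i
        ≤ ∑ i ∈ Finset.range n, 2 * (√(t i) - √(t (i + 1))) := Finset.sum_le_sum fun i _ => key i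
      _ = 2 * (√(t 0) - √(t n)) := by rw [← Finset.mul_sum, Finset.sum_range_sub']
      _ ≤ 2 * √(t 0) := by linarith [Real.sqrt_nonneg (t n)]

/-! ### Functionals, barycenters and weak convergence -/

section LocallyConvex

variable {E : Type*} [AddCommGroup E] [Module ℝ E] [TopologicalSpace E]

theorem exists_bound_of_isVonNBounded {D : Set E} (hD : Bornology.IsVonNBounded ℝ D)
    (φ : E →L[ℝ] ℝ) : ∃ u : ℝ, 0 < u ∧ ∀ x ∈ D, |φ x| ≤ u := by
  have h := (NormedSpace.isVonNBounded_iff ℝ).1 (hD.image φ)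
  obtain ⟨u, hu, h⟩ := h.exists_pos_norm_le
  exact ⟨u, hu, fun x hx => h _ (mem_image_of_mem φ hx)⟩

theorem enorm_apply_le_mul_egauge {D : Set E} {φ : E →L[ℝ] ℝ} {u : ℝ} (hu : 0 < u)
    (h : ∀ x ∈ D, |φ x| ≤ u) (x : E) : ‖φ x‖ₑ ≤ ENNReal.ofReal u * egauge ℝ D x := by
  rw [mul_comm, ← ENNReal.div_le_iff (by simpa using hu) ENNReal.ofReal_ne_top, le_egauge_iff]
  rintro c ⟨d, hd, rfl⟩
  rw [ENNReal.div_le_iff (by simpa using hu) ENNReal.ofReal_ne_top]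
  simp only [map_smul, smul_eq_mul, enorm_mul]
  gcongr
  rw [Real.enorm_eq_ofReal_abs]
  exact ENNReal.ofReal_le_ofReal (h d hd)

/-- Existence of barycenters: the Pettis integral of a compact-convex-valued function against a
probability measure exists and lies in the compact convex set. -/
theorem exists_mem_forall_eq_integral {X : Type*} [MeasurableSpace X] {μ : Measure X}
    [IsProbabilityMeasure μ] {g : X → E} {C : Set E} (hC : IsCompact C) (hc : Convex ℝ C)
    (hg : ∀ᵐ x ∂μ, g x ∈ C) (hi : ∀ φ : E →L[ℝ] ℝ, Integrable (fun x => φ (g x)) μ) :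
    ∃ c ∈ C, ∀ φ : E →L[ℝ] ℝ, φ c = ∫ x, φ (g x) ∂μ := by
  have := hC.inter_iInter_nonempty
    (fun φ : E →L[ℝ] ℝ => {c : E | φ c = ∫ x, φ (g x) ∂μ})
    (fun φ => isClosed_eq φ.continuous continuous_const) fun s => ?_
  · obtain ⟨c, hcC, h⟩ := this
    exact ⟨c, hcC, fun φ => mem_iInter.1 h φ⟩
  · -- For finitely many functionals, average in the compact convex image of `C` in `ℝˢ`.
    let Φ : E →L[ℝ] ({φ // φ ∈ s} → ℝ) := ContinuousLinearMap.pi fun φ => (φ : E →L[ℝ] ℝ)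
    have hΦ : ∫ x, Φ (g x) ∂μ ∈ Φ '' C := by
      refine Convex.integral_mem (hc.linear_image Φ.toLinearMap)
        (hC.image Φ.continuous).isClosed (hg.mono fun x hx => mem_image_of_mem Φ hx) ?_
      exact Integrable.of_eval fun φ => hi φ
    obtain ⟨c, hcC, h⟩ := hΦ
    refine ⟨c, hcC, mem_iInter₂.2 fun φ hφ => ?_⟩
    exact (congrFun h ⟨φ, hφ⟩).trans
      (eval_integral (f := fun x => Φ (g x)) (fun ψ : {φ // φ ∈ s} => hi ψ) ⟨φ, hφ⟩)

theorem exists_forall_eq_integral {X : Type*} [MeasurableSpace X] {μ : Measure X}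
    [IsFiniteMeasure μ] {g : X → E} {C : Set E} (hC : IsCompact C) (hc : Convex ℝ C)
    (hg : ∀ᵐ x ∂μ, g x ∈ C) (hi : ∀ φ : E →L[ℝ] ℝ, Integrable (fun x => φ (g x)) μ) :
    ∃ e : E, ∀ φ : E →L[ℝ] ℝ, φ e = ∫ x, φ (g x) ∂μ := by
  rcases eq_zero_or_neZero μ with rfl | h0
  · exact ⟨0, by simp⟩
  have hu : μ univ ≠ 0 := by simpa using h0.out
  have : IsProbabilityMeasure ((μ univ)⁻¹ • μ) := inferInstance
  obtain ⟨c, -, h⟩ := exists_mem_forall_eq_integral (μ := (μ univ)⁻¹ • μ) hC hc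
    (Measure.ae_smul_measure hg _)
    fun φ => (hi φ).smul_measure (ENNReal.inv_ne_top.2 hu)
  refine ⟨(μ univ).toReal • c, fun φ => ?_⟩
  rw [map_smul, h φ, integral_smul_measure, ENNReal.toReal_inv, smul_smul,
    mul_inv_cancel₀ (ENNReal.toReal_ne_zero.2 ⟨hu, measure_ne_top _ _⟩), one_smul]

variable [IsTopologicalAddGroup E] [ContinuousSMul ℝ E]

/-- A Cauchy filter that converges weakly converges to the same limit in the original topology,
because zero has a basis of closed convex, hence weakly closed, neighbourhoods. -/
theorem le_nhds_of_cauchy_of_forall_tendsto [LocallyConvexSpace ℝ E] {F : Filter E}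
    (hF : ∀ U ∈ 𝓝 (0 : E), ∃ A ∈ F, ∀ a ∈ A, ∀ b ∈ A, a - b ∈ U) [F.NeBot] {x : E}
    (hx : ∀ φ : E →L[ℝ] ℝ, Tendsto φ F (𝓝 (φ x))) : F ≤ 𝓝 x := by
  intro V hV
  have hV' : (fun y => x + y) ⁻¹' V ∈ 𝓝 (0 : E) :=
    (continuous_const_add x).continuousAt.preimage_mem_nhds (by simpa using hV)
  obtain ⟨W, hW, hWc, hWV⟩ := exists_mem_nhds_isClosed_subset hV'
  obtain ⟨U, ⟨hU, hUc⟩, hUW⟩ := (LocallyConvexSpace.convex_basis_zero ℝ E).mem_iff.1 hW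
  obtain ⟨A, hA, hAU⟩ := hF U hU
  refine mem_of_superset hA fun a ha => ?_
  have hax : a - x ∈ closure U := by
    by_contra hn
    obtain ⟨φ, u, h1, h2⟩ := geometric_hahn_banach_closed_point hUc.closure isClosed_closure hn
    have h3 : φ (a - x) ≤ u := by
      rw [map_sub]
      refine le_of_tendsto (tendsto_const_nhds.sub (hx φ)) (mem_of_superset hA fun b hb => ?_)
      have := h1 _ (subset_closure (hAU a ha b hb))
      rw [map_sub] at this
      exact this.le
    linarith
  have := hWV (closure_minimal hUW hWc hax)
  simpa using this

end LocallyConvex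

/-! ### Exhaustion by compact metrizable sets -/

theorem exists_seq_measure_sdiff_iUnion_eq_zero {X : Type*} [MeasurableSpace X] {ν : Measure X}
    {p : Set X → Prop} {B : Set X} (hB : ν B ≠ ∞) (h0 : p ∅)
    (h : ∀ r < ν B, ∃ K ⊆ B, MeasurableSet K ∧ p K ∧ r < ν K) :
    ∃ K : ℕ → Set X, (∀ n, K n ⊆ B ∧ MeasurableSet (K n) ∧ p (K n)) ∧
      ν (B \ ⋃ n, K n) = 0 := by
  by_cases hz : ν B = 0
  · exact ⟨fun _ => ∅, fun _ => ⟨empty_subset _, .empty, h0⟩, measure_mono_null sdiff_subset hz⟩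
  have hlt (n : ℕ) : ν B - (n + 1 : ℝ≥0∞)⁻¹ < ν B :=
    ENNReal.sub_lt_self hB hz (ENNReal.inv_ne_zero.2 (by finiteness))
  choose K hKB hK hp hr using fun n : ℕ => h _ (hlt n)
  refine ⟨K, fun n => ⟨hKB n, hK n, hp n⟩, le_antisymm ?_ zero_le⟩
  have ht : Tendsto (fun n : ℕ => (n + 1 : ℝ≥0∞)⁻¹) atTop (𝓝 0) := by
    simpa using (tendsto_add_atTop_iff_nat 1).2 ENNReal.tendsto_inv_nat_nhds_zero
  refine ge_of_tendsto' ht fun n => ?_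
  calc ν (B \ ⋃ n, K n) ≤ ν (B \ K n) := measure_mono (sdiff_subset_sdiff_right (subset_iUnion K n))
    _ = ν B - ν (K n) := measure_sdiff (hKB n) (hK n).nullMeasurableSet
        (ne_top_of_le_ne_top hB (measure_mono (hKB n)))
    _ ≤ (n + 1 : ℝ≥0∞)⁻¹ := by
      rw [tsub_le_iff_left, ← tsub_le_iff_right]
      exact (hr n).le

/-- Metric regularity of the measure and Lusin measurability of `g` combine: a compact metrizable
subset of a compact set on which `g` is continuous inherits continuity of `g`. -/
theorem LusinMeasurable.exists_metrizable_lt {X E : Type*} [TopologicalSpace X]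
    [MeasurableSpace X] [TopologicalSpace E] {ν : Measure X} {g : X → E}
    (hg : LusinMeasurable ν g) (hν : MetricallyRegular ν) {B : Set X} (hB : MeasurableSet B)
    {r : ℝ≥0∞} (hr : r < ν B) :
    ∃ K ⊆ B, MeasurableSet K ∧ (IsCompact K ∧ MetrizableSpace K ∧ ContinuousOn g K) ∧
      r < ν K := by
  rw [hg B hB] at hr
  simp only [lt_iSup_iff] at hr
  obtain ⟨L, hLB, hL, -, hLc, hr⟩ := hr
  rw [hν L hL] at hr
  simp only [lt_iSup_iff] at hr
  obtain ⟨K, hKL, hK, hKc, hKm, hr⟩ := hr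
  exact ⟨K, hKL.trans hLB, hK, ⟨hKc, hKm, hLc.mono hKL⟩, hr⟩

/-- The set where an integrable function `f` does not vanish is covered, up to a null set, by
countably many compact metrizable sets of finite measure on which `g` is continuous. Finite
measure comes from Markov's inequality on the sets `{x | (m + 1)⁻¹ ≤ f x}`. -/
theorem LusinMeasurable.exists_seq_cover {X E : Type*} [TopologicalSpace X]
    [MeasurableSpace X] [TopologicalSpace E] {ν : Measure X} {g : X → E}
    (hg : LusinMeasurable ν g) (hν : MetricallyRegular ν) {f : X → ℝ≥0∞} (hf : Measurable f)
    (hfi : ∫⁻ x, f x ∂ν ≠ ∞) :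
    ∃ K : ℕ → Set X, (∀ n, MeasurableSet (K n) ∧ ν (K n) ≠ ∞ ∧ IsCompact (K n) ∧
      MetrizableSpace (K n) ∧ ContinuousOn g (K n)) ∧ ∀ᵐ x ∂ν, x ∉ ⋃ n, K n → f x = 0 := by
  let S : ℕ → Set X := fun m => {x | (m + 1 : ℝ≥0∞)⁻¹ ≤ f x}
  have hS (m : ℕ) : MeasurableSet (S m) := measurableSet_le measurable_const hf
  have hSf (m : ℕ) : ν (S m) ≠ ∞ :=
    (meas_ge_le_lintegral_div hf.aemeasurable (ENNReal.inv_ne_zero.2 (by finiteness))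
      (ENNReal.inv_ne_top.2 (by simp))).trans_lt
      (ENNReal.div_lt_top hfi (ENNReal.inv_ne_zero.2 (by finiteness))) |>.ne
  choose K hK hKS using fun m => exists_seq_measure_sdiff_iUnion_eq_zero
    (p := fun K => IsCompact K ∧ MetrizableSpace K ∧ ContinuousOn g K) (hSf m)
    ⟨isCompact_empty, inferInstance, continuousOn_empty g⟩
    fun r hr => hg.exists_metrizable_lt hν (hS m) hr
  refine ⟨fun n => K n.unpair.1 n.unpair.2, fun n => ?_, ?_⟩
  · obtain ⟨h1, h2, h3⟩ := hK n.unpair.1 n.unpair.2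
    exact ⟨h2, ne_top_of_le_ne_top (hSf _) (measure_mono h1), h3⟩
  · have h : ∀ᵐ x ∂ν, ∀ m, x ∉ S m \ ⋃ j, K m j :=
      ae_all_iff.2 fun m => measure_eq_zero_iff_ae_notMem.1 (hKS m)
    filter_upwards [h] with x hx hxK
    by_contra h0
    obtain ⟨m, hm⟩ := ENNReal.exists_inv_nat_lt h0
    refine hx m ⟨?_, fun hxm => hxK ?_⟩
    · refine le_trans ?_ hm.le
      gcongr
      exact le_self_add
    · obtain ⟨j, hj⟩ := mem_iUnion.1 hxm
      exact mem_iUnion.2 ⟨Nat.pair m j, by simpa using hj⟩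

/-! ### Pettis integrals under metric convex compactness -/

section PettisIntegral

variable {E : Type*} [AddCommGroup E] [Module ℝ E] [TopologicalSpace E]
  [IsTopologicalAddGroup E] [ContinuousSMul ℝ E]

/-- A series that is absolutely convergent for the gauge of a bounded set converges weakly. The limit
is the Pettis integral over `ℕ`, against the finite measure with point masses `l n * b n`, of the null
sequence `e n / (l n * b n)`, whose closed convex hull is compact. -/
theorem MetricConvexCompact.exists_hasSum [T2Space E] (hE : MetricConvexCompact E) {D : Set E}
    (hDb : Bornology.IsVonNBounded ℝ D) {b : ℕ → ℝ} (hb : ∀ n, 0 < b n) (hs : Summable b)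
    {e : ℕ → E} (he : ∀ n, (b n)⁻¹ • e n ∈ D) :
    ∃ s : E, ∀ φ : E →L[ℝ] ℝ, HasSum (fun n => φ (e n)) (φ s) := by
  obtain ⟨l, hl, hlt, hls⟩ := exists_tendsto_atTop_summable_mul hb hs
  let y : ℕ → E := fun n => (l n)⁻¹ • (b n)⁻¹ • e n
  have hy : Tendsto y atTop (𝓝 0) :=
    hDb.smul_tendsto_zero (Eventually.of_forall he) hlt.inv_tendsto_atTop
  have hC := hE _ hy.isCompact_insert_range (metrizableSpace_insert_range hy)
  let c : ℕ → ℝ := fun n => l n * b n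
  have hc0 (n : ℕ) : 0 < c n := mul_pos (hl n) (hb n)
  let μ : Measure ℕ := Measure.sum fun n => ENNReal.ofReal (c n) • Measure.dirac n
  have hμ : IsFiniteMeasure μ := ⟨by
    simp only [μ, Measure.sum_apply _ MeasurableSet.univ, Measure.smul_apply, measure_univ,
      smul_eq_mul, mul_one]
    rw [← ENNReal.ofReal_tsum_of_nonneg (fun n => (hc0 n).le) hls]
    exact ENNReal.ofReal_lt_top⟩
  have hyC (n : ℕ) : y n ∈ closedConvexHull ℝ (insert 0 (range y)) :=
    subset_closedConvexHull (mem_insert_of_mem _ (mem_range_self n))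
  have hi (φ : E →L[ℝ] ℝ) : Integrable (fun n => φ (y n)) μ := by
    obtain ⟨u, -, hu⟩ := exists_bound_of_isVonNBounded (hC.isVonNBounded ℝ) φ
    exact Integrable.of_bound (by fun_prop) u (Eventually.of_forall fun n => hu _ (hyC n))
  obtain ⟨s, hs⟩ := exists_forall_eq_integral (μ := μ) hC convex_closedConvexHull
    (Eventually.of_forall hyC) hi
  refine ⟨s, fun φ => ?_⟩
  rw [hs φ]
  have hφe : (fun n => φ (e n)) =
      fun n => ∫ k, φ (y k) ∂(ENNReal.ofReal (c n) • Measure.dirac n) := funext fun n => ?_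
  · rw [hφe]
    exact hasSum_integral_measure (hi φ)
  rw [integral_smul_measure, integral_dirac, ENNReal.toReal_ofReal (hc0 n).le]
  simp only [y, c, map_smul, smul_eq_mul]
  field_simp [(hl n).ne', (hb n).ne']

variable [LocallyConvexSpace ℝ E]

/-- The gauge of a Pettis integral is at most the integral of the gauge. -/
theorem inv_smul_mem_of_forall_eq_integral {X : Type*} [MeasurableSpace X] {μ : Measure X}
    {g : X → E} {D : Set E} (hDc : IsClosed D)
    (hD : AbsConvex ℝ D) (hDn : D.Nonempty) {f : X → ℝ≥0∞} (hf : AEMeasurable f μ)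
    (hfg : ∀ᵐ x ∂μ, egauge ℝ D (g x) ≤ f x) {b : ℝ} (hb : 0 < b)
    (hfb : ∫⁻ x, f x ∂μ ≤ ENNReal.ofReal b) {e : E}
    (he : ∀ φ : E →L[ℝ] ℝ, φ e = ∫ x, φ (g x) ∂μ) : b⁻¹ • e ∈ D := by
  by_contra hn
  obtain ⟨φ, u, h1, h2⟩ := geometric_hahn_banach_closed_point hD.2 hDc hn
  have hu : 0 < u := by simpa using h1 0 (hD.1.zero_mem hDn)
  have hφ : ∀ x ∈ D, |φ x| ≤ u := fun x hx => abs_le.2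
    ⟨by have := h1 _ (hD.1.neg_mem_iff.2 hx); rw [map_neg] at this; linarith, (h1 x hx).le⟩
  have hle : ‖∫ x, φ (g x) ∂μ‖ₑ ≤ ENNReal.ofReal (u * b) := calc
    ‖∫ x, φ (g x) ∂μ‖ₑ ≤ ∫⁻ x, ‖φ (g x)‖ₑ ∂μ := enorm_integral_le_lintegral_enorm _
    _ ≤ ∫⁻ x, ENNReal.ofReal u * f x ∂μ := by
      refine lintegral_mono_ae (hfg.mono fun x hx => ?_)
      exact (enorm_apply_le_mul_egauge hu hφ _).trans (by gcongr)
    _ = ENNReal.ofReal u * ∫⁻ x, f x ∂μ := lintegral_const_mul'' _ hf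
    _ ≤ ENNReal.ofReal (u * b) := by
      rw [ENNReal.ofReal_mul hu.le]
      gcongr
  rw [← he, Real.enorm_eq_ofReal_abs, ENNReal.ofReal_le_ofReal_iff (by positivity)] at hle
  rw [map_smul, smul_eq_mul, lt_inv_mul_iff₀ hb] at h2
  linarith [le_abs_self (φ e)]

theorem MetricConvexCompact.pettisIntegrable [T2Space E] (hE : MetricConvexCompact E) {X : Type*}
    [TopologicalSpace X] [MeasurableSpace X] [BorelSpace X] {ν : Measure X}
    (hν : MetricallyRegular ν) {D : Set E} (hDb : Bornology.IsVonNBounded ℝ D)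
    (hDc : IsClosed D) (hD : AbsConvex ℝ D) {g : X → E} (hg : LusinMeasurable ν g)
    (hm : AEMeasurable (fun x => egauge ℝ D (g x)) ν)
    (hi : ∫⁻ x, egauge ℝ D (g x) ∂ν < ∞) : PettisIntegrable ν g := by
  rcases D.eq_empty_or_nonempty with rfl | hDn
  · -- The gauge of the empty set is infinite everywhere, so its integral is finite only if `ν = 0`.
    have : ν = 0 := by
      by_contra h
      simp [ENNReal.top_mul, h] at hi
    subst this
    exact ⟨fun φ => integrable_zero_measure, 0, by simp⟩
  obtain ⟨f, hf, hgf⟩ := hm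
  have hfi : ∫⁻ x, f x ∂ν ≠ ∞ := by rw [← lintegral_congr_ae hgf]; exact hi.ne
  obtain ⟨K, hK, hKf⟩ := hg.exists_seq_cover hν hf hfi
  let A : ℕ → Set X := disjointed K
  have hA (n : ℕ) : MeasurableSet (A n) := .disjointed (fun n => (hK n).1) n
  have hAK (n : ℕ) : A n ⊆ K n := disjointed_subset K n
  have hAd : Pairwise (Function.onFun Disjoint A) := disjoint_disjointed K
  have hAU : ⋃ n, A n = ⋃ n, K n := iUnion_disjointed
  have hg0 : ∀ᵐ x ∂ν, x ∉ ⋃ n, A n → g x = 0 := by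
    filter_upwards [hgf, hKf] with x h1 h2 h3
    rw [hAU] at h3
    -- A vector of zero gauge is zero because `D` is bounded and `E` is Hausdorff.
    have h4 : egauge ℝ D (g x) = 0 := h1.trans (h2 h3)
    by_contra h5
    obtain ⟨φ, hφ⟩ := SeparatingDual.exists_ne_zero (R := ℝ) h5
    obtain ⟨u, hu, h⟩ := exists_bound_of_isVonNBounded hDb φ
    have := enorm_apply_le_mul_egauge hu h (g x)
    rw [h4, mul_zero] at this
    simp [hφ] at this
  have hφA (φ : E →L[ℝ] ℝ) : (⋃ n, A n).indicator (fun x => φ (g x)) =ᵐ[ν] fun x => φ (g x) := by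
    filter_upwards [hg0] with x hx
    by_cases h : x ∈ ⋃ n, A n
    · rw [indicator_of_mem h]
    · rw [indicator_of_notMem h, hx h, map_zero]
  have hφi (φ : E →L[ℝ] ℝ) : Integrable (fun x => φ (g x)) ν := by
    obtain ⟨u, hu, h⟩ := exists_bound_of_isVonNBounded hDb φ
    refine ⟨AEMeasurable.aestronglyMeasurable (AEMeasurable.congr ?_ (hφA φ)), ?_⟩
    · rw [aemeasurable_indicator_iff (.iUnion hA), aemeasurable_iUnion_iff]
      exact fun n => ((φ.continuous.comp_continuousOn (hK n).2.2.2.2).mono (hAK n)).aemeasurable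
        (hA n)
    · calc ∫⁻ x, ‖φ (g x)‖ₑ ∂ν ≤ ∫⁻ x, ENNReal.ofReal u * egauge ℝ D (g x) ∂ν :=
          lintegral_mono fun x => enorm_apply_le_mul_egauge hu h _
        _ = ENNReal.ofReal u * ∫⁻ x, egauge ℝ D (g x) ∂ν :=
          lintegral_const_mul' _ _ ENNReal.ofReal_ne_top
        _ < ∞ := ENNReal.mul_lt_top ENNReal.ofReal_lt_top hi
  refine ⟨hφi, ?_⟩
  have he (n : ℕ) : ∃ e : E, ∀ φ : E →L[ℝ] ℝ, φ e = ∫ x in A n, φ (g x) ∂ν := by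
    obtain ⟨-, h1, h2, h3, h4⟩ := hK n
    have : IsFiniteMeasure (ν.restrict (A n)) :=
      isFiniteMeasure_restrict.2 (ne_top_of_le_ne_top h1 (measure_mono (hAK n)))
    refine exists_forall_eq_integral (hE _ (h2.image_of_continuousOn h4)
      (metrizableSpace_image h2 h3 h4)) convex_closedConvexHull ?_ fun φ => (hφi φ).restrict
    filter_upwards [ae_restrict_mem (hA n)] with x hx
    exact subset_closedConvexHull (mem_image_of_mem g (hAK n hx))
  choose e he using he
  have hsum : ∑' n, ∫⁻ x in A n, f x ∂ν ≠ ∞ := by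
    rw [← lintegral_iUnion hA hAd]
    exact ne_top_of_le_ne_top hfi (setLIntegral_le_lintegral _ _)
  -- The summand `2⁻ⁿ` only serves to make the bounds positive.
  let b : ℕ → ℝ := fun n => (∫⁻ x in A n, f x ∂ν).toReal + (1 / 2) ^ n
  have hb (n : ℕ) : 0 < b n := add_pos_of_nonneg_of_pos ENNReal.toReal_nonneg (by positivity)
  have hbs : Summable b := (ENNReal.summable_toReal hsum).add summable_geometric_two
  obtain ⟨s, hs⟩ := hE.exists_hasSum hDb hb hbs fun n => by
    refine inv_smul_mem_of_forall_eq_integral hDc hD hDn hf.aemeasurable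
      (ae_restrict_of_ae (hgf.mono fun x hx => hx.le)) (hb n) ?_ (he n)
    rw [ENNReal.le_ofReal_iff_toReal_le (ENNReal.ne_top_of_tsum_ne_top hsum n) (hb n).le]
    exact le_add_of_nonneg_right (by positivity)
  refine ⟨s, fun φ => (hs φ).unique ?_⟩
  simp only [he]
  rw [← integral_congr_ae (hφA φ), integral_indicator (.iUnion hA)]
  exact hasSum_integral_iUnion hA hAd (hφi φ).integrableOn

end PettisIntegral

/-! ### Compactness of closed convex hulls from Pettis integrals -/

section WeakCompactness

theorem metricallyRegular_of_isFiniteMeasure {X : Type*} [TopologicalSpace X] [CompactSpace X]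
    [MetrizableSpace X] [MeasurableSpace X] [BorelSpace X] (ν : Measure X) [IsFiniteMeasure ν] :
    MetricallyRegular ν := fun B hB => by
  refine le_antisymm ?_ (by simp only [iSup_le_iff]; exact fun K h _ _ _ => measure_mono h)
  rw [hB.measure_eq_iSup_isClosed_of_ne_top (measure_ne_top ν B)]
  simp only [iSup_le_iff]
  intro K hKB hK
  exact le_iSup_of_le K <| le_iSup_of_le hKB <| le_iSup_of_le hK.measurableSet <|
    le_iSup_of_le hK.isCompact <| le_iSup_of_le inferInstance le_rfl

theorem Continuous.lusinMeasurable {X E : Type*} [TopologicalSpace X] [CompactSpace X]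
    [MetrizableSpace X] [MeasurableSpace X] [BorelSpace X] [TopologicalSpace E] {g : X → E}
    (hg : Continuous g) (ν : Measure X) [IsFiniteMeasure ν] : LusinMeasurable ν g := fun B hB => by
  refine le_antisymm ?_ (by simp only [iSup_le_iff]; exact fun K h _ _ _ => measure_mono h)
  rw [hB.measure_eq_iSup_isClosed_of_ne_top (measure_ne_top ν B)]
  simp only [iSup_le_iff]
  intro K hKB hK
  exact le_iSup_of_le K <| le_iSup_of_le hKB <| le_iSup_of_le hK.measurableSet <|
    le_iSup_of_le hK.isCompact <| le_iSup_of_le hg.continuousOn le_rfl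

/-- The lift of the Cantor space puts the domain in a prescribed universe, unrelated to that of `Y`. -/
theorem exists_ulift_cantor_range_eq {Y : Type*} [TopologicalSpace Y] {K : Set Y}
    (hK : IsCompact K) (hm : MetrizableSpace K) (hne : K.Nonempty) :
    ∃ f : ULift.{v} (ℕ → Bool) → Y, Continuous f ∧ range f = K := by
  have : CompactSpace K := isCompact_iff_compactSpace.1 hK
  have : Nonempty K := hne.to_subtype
  let := metrizableSpaceMetric K
  obtain ⟨f, hf, hs⟩ := exists_nat_bool_continuous_surjective_of_compact K
  refine ⟨fun x => f x.down, continuous_subtype_val.comp (hf.comp continuous_uliftDown), ?_⟩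
  ext y
  constructor
  · rintro ⟨x, rfl⟩
    exact (f x.down).2
  · intro hy
    obtain ⟨x, hx⟩ := hs ⟨y, hy⟩
    exact ⟨⟨x⟩, by simp [hx]⟩

/-- The strict sublevel sets of the gauge of a closed balanced set `D` are countable unions of closed
sets `q • D` with `q` rational. -/
theorem measurable_egauge_comp {E X : Type*} [AddCommGroup E] [Module ℝ E]
    [TopologicalSpace E] [ContinuousSMul ℝ E] [TopologicalSpace X] [MeasurableSpace X]
    [OpensMeasurableSpace X] {D : Set E} (hD : Balanced ℝ D) (hDc : IsClosed D) {f : X → E}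
    (hf : Continuous f) : Measurable fun x => egauge ℝ D (f x) := by
  refine measurable_of_Iio fun r => ?_
  have hr : (fun x => egauge ℝ D (f x)) ⁻¹' Iio r =
      ⋃ q : {q : ℚ // 0 < q ∧ ENNReal.ofReal q < r}, f ⁻¹' (((q : ℚ) : ℝ) • D) := by
    ext x
    simp only [mem_preimage, mem_Iio, mem_iUnion, Subtype.exists, exists_prop]
    constructor
    · intro h
      obtain ⟨q, -, h1, h2⟩ := ENNReal.lt_iff_exists_rat_btwn.1 h
      have hq : 0 < q := by
        by_contra hq
        have : ((q : ℝ)).toNNReal = 0 := Real.toNNReal_of_nonpos (by exact_mod_cast not_lt.1 hq)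
        simp [this] at h1
      refine ⟨q, ⟨hq, h2⟩, mem_smul_of_egauge_lt hD ?_⟩
      rwa [Real.enorm_of_nonneg (by exact_mod_cast hq.le)]
    · rintro ⟨q, ⟨hq, h2⟩, h⟩
      refine (egauge_le_of_mem_smul h).trans_lt ?_
      rwa [Real.enorm_of_nonneg (by exact_mod_cast hq.le)]
  rw [hr]
  refine .iUnion fun q => (IsClosed.preimage hf ?_).measurableSet
  exact hDc.smul_of_ne_zero (by exact_mod_cast q.2.1.ne')

variable {E : Type*} [AddCommGroup E] [Module ℝ E] [TopologicalSpace E]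
  [IsTopologicalAddGroup E] [ContinuousSMul ℝ E] [LocallyConvexSpace ℝ E]

theorem isVonNBounded_closedAbsConvexHull {K : Set E} (hK : IsCompact K) :
    Bornology.IsVonNBounded ℝ (closedAbsConvexHull ℝ K) := by
  let : UniformSpace E := IsTopologicalAddGroup.rightUniformSpace E
  have : IsUniformAddGroup E := isUniformAddGroup_of_addCommGroup
  rw [closedAbsConvexHull_eq_closure_absConvexHull]
  exact hK.totallyBounded.absConvexHull.closure.isVonNBounded ℝ

theorem mem_closedConvexHull_range_of_forall_eq_integral {X : Type*} [MeasurableSpace X]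
    {μ : Measure X} [IsProbabilityMeasure μ] {f : X → E} {e : E}
    (hi : ∀ φ : E →L[ℝ] ℝ, Integrable (fun x => φ (f x)) μ)
    (he : ∀ φ : E →L[ℝ] ℝ, φ e = ∫ x, φ (f x) ∂μ) : e ∈ closedConvexHull ℝ (range f) := by
  by_contra hn
  obtain ⟨φ, u, h1, h2⟩ := geometric_hahn_banach_closed_point convex_closedConvexHull
    isClosed_closedConvexHull hn
  have h3 : ∫ x, φ (f x) ∂μ ≤ ∫ _, u ∂μ := integral_mono (hi φ) (integrable_const u)
    fun x => (h1 _ (subset_closedConvexHull (mem_range_self x))).le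
  rw [← he] at h3
  simp only [integral_const, probReal_univ, one_smul] at h3
  linarith

/-- An ultrafilter containing the closed convex hull of a compact set is Cauchy, since that hull is
totally bounded. -/
theorem exists_mem_ultrafilter_sub_mem {K : Set E} (hK : IsCompact K) {F : Ultrafilter E}
    (hF : closedConvexHull ℝ K ∈ F) {U : Set E} (hU : U ∈ 𝓝 (0 : E)) :
    ∃ A ∈ F, ∀ a ∈ A, ∀ b ∈ A, a - b ∈ U := by
  let : UniformSpace E := IsTopologicalAddGroup.rightUniformSpace E
  have : IsUniformAddGroup E := isUniformAddGroup_of_addCommGroup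
  have ht : TotallyBounded (closedConvexHull ℝ K) := by
    rw [closedConvexHull_eq_closure_convexHull]
    exact hK.totallyBounded.convexHull.closure
  have hc : Cauchy (F : Filter E) := totallyBounded_iff_ultrafilter.1 ht F (le_principal_iff.2 hF)
  obtain ⟨A, hA, h⟩ := (cauchy_iff.1 hc).2 _ (by
    rw [uniformity_eq_comap_nhds_zero_swapped]
    exact preimage_mem_comap hU)
  exact ⟨A, hA, fun a ha b hb => h (mk_mem_prod ha hb)⟩

variable [T2Space E]

theorem isCompact_closedConvexHull_range_of_pettisIntegrable {X : Type*} [TopologicalSpace X]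
    [CompactSpace X] [T2Space X] [MeasurableSpace X] [BorelSpace X] {f : X → E}
    (hf : Continuous f) (h : ∀ μ : ProbabilityMeasure X, PettisIntegrable (μ : Measure X) f) :
    IsCompact (closedConvexHull ℝ (range f)) := by
  choose hi e he using h
  have hmem (μ : ProbabilityMeasure X) : e μ ∈ closedConvexHull ℝ (range f) :=
    mem_closedConvexHull_range_of_forall_eq_integral (hi μ) (he μ)
  have hext {x y : E} (hxy : ∀ φ : E →L[ℝ] ℝ, φ x = φ y) : x = y := by
    by_contra hne
    obtain ⟨φ, hφ⟩ := SeparatingDual.exists_separating_of_ne (R := ℝ) hne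
    exact hφ (hxy φ)
  have hM : IsCompact (range e) := by
    rw [isCompact_iff_ultrafilter_le_nhds]
    intro F hF
    obtain ⟨G, rfl⟩ : ∃ G : Ultrafilter (ProbabilityMeasure X), G.map e = F := by
      refine ⟨F.ofComapInfPrincipal (m := e) (s := univ) ?_, ?_⟩
      · simpa using hF
      · exact Ultrafilter.ofComapInfPrincipal_eq_of_map _
    obtain ⟨μ, -, hμ⟩ := isCompact_iff_ultrafilter_le_nhds.1 isCompact_univ G (by simp)
    refine ⟨e μ, mem_range_self μ, le_nhds_of_cauchy_of_forall_tendsto (fun U hU =>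
      exists_mem_ultrafilter_sub_mem (isCompact_range hf) (F := G.map e) ?_ hU) fun φ => ?_⟩
    · exact Ultrafilter.mem_map.2 (univ_mem' hmem)
    · have h1 := (ProbabilityMeasure.tendsto_iff_forall_integral_tendsto
        (F := (G : Filter (ProbabilityMeasure X))) (μs := id) (μ := μ)).1 (tendsto_id'.2 hμ)
        (BoundedContinuousFunction.mkOfCompact ⟨fun x => φ (f x), φ.continuous.comp hf⟩)
      rw [Ultrafilter.coe_map, tendsto_map'_iff, he]
      refine h1.congr fun ρ => ?_
      exact (he ρ φ).symm
  have hc : Convex ℝ (range e) := by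
    rintro _ ⟨μ, rfl⟩ _ ⟨ρ, rfl⟩ a b ha hb hab
    let ν : Measure X := ENNReal.ofReal a • (μ : Measure X) + ENNReal.ofReal b • (ρ : Measure X)
    have hν : IsProbabilityMeasure ν := ⟨by
      simp [ν, ← ENNReal.ofReal_add ha hb, hab]⟩
    refine ⟨(⟨ν, hν⟩ : ProbabilityMeasure X), hext fun φ => ?_⟩
    refine (he _ φ).trans ?_
    rw [map_add, map_smul, map_smul, he, he, ProbabilityMeasure.coe_mk,
      integral_add_measure ((hi μ φ).smul_measure ENNReal.ofReal_ne_top)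
      ((hi ρ φ).smul_measure ENNReal.ofReal_ne_top), integral_smul_measure, integral_smul_measure,
      ENNReal.toReal_ofReal ha, ENNReal.toReal_ofReal hb]
  have hsub : range f ⊆ range e := by
    rintro _ ⟨x, rfl⟩
    refine ⟨(⟨Measure.dirac x, inferInstance⟩ : ProbabilityMeasure X), hext fun φ => ?_⟩
    exact (he _ φ).trans (integral_dirac' _ _ (φ.continuous.comp hf).stronglyMeasurable)
  exact hM.of_isClosed_subset isClosed_closedConvexHull
    (closedConvexHull_min hsub hc hM.isClosed)

end WeakCompactness

theorem theorem2 (E : Type u) [AddCommGroup E] [Module ℝ E] [TopologicalSpace E]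
    [IsTopologicalAddGroup E] [ContinuousSMul ℝ E] [LocallyConvexSpace ℝ E] [T2Space E] :
    MetricConvexCompact E ↔
      ∀ (X : Type v) [TopologicalSpace X] [MeasurableSpace X] [BorelSpace X] (ν : Measure X),
        MetricallyRegular ν →
        ∀ D : Set E, Bornology.IsVonNBounded ℝ D → IsClosed D → AbsConvex ℝ D →
        ∀ g : X → E, LusinMeasurable ν g →
          AEMeasurable (fun x => egauge ℝ D (g x)) ν →
          ∫⁻ x, egauge ℝ D (g x) ∂ν < ⊤ →
          PettisIntegrable ν g := by
  refine ⟨fun hE X _ _ _ ν hν D hDb hDc hD g hg hm hi =>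
    hE.pettisIntegrable hν hDb hDc hD hg hm hi, fun h K hK hm => ?_⟩
  rcases K.eq_empty_or_nonempty with rfl | hne
  · rw [closedConvexHull_eq_closure_convexHull]
    simp
  obtain ⟨f, hf, rfl⟩ := exists_ulift_cantor_range_eq.{v} hK hm hne
  let : MeasurableSpace (ULift.{v} (ℕ → Bool)) := borel _
  have : BorelSpace (ULift.{v} (ℕ → Bool)) := ⟨rfl⟩
  have : MetrizableSpace (ULift.{v} (ℕ → Bool)) :=
    Topology.IsEmbedding.uliftDown.metrizableSpace
  refine isCompact_closedConvexHull_range_of_pettisIntegrable hf fun μ => ?_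
  let D : Set E := closedAbsConvexHull ℝ (range f)
  have hD : IsClosed D := isClosed_closedAbsConvexHull
  have hDa : AbsConvex ℝ D := absConvex_convexClosedHull
  refine h _ μ (metricallyRegular_of_isFiniteMeasure _) D (isVonNBounded_closedAbsConvexHull hK)
    hD hDa f (hf.lusinMeasurable _) (measurable_egauge_comp hDa.1 hD hf).aemeasurable ?_
  calc ∫⁻ x, egauge ℝ D (f x) ∂(μ : Measure (ULift.{v} (ℕ → Bool)))
      ≤ ∫⁻ _, 1 ∂(μ : Measure (ULift.{v} (ℕ → Bool))) :=
        lintegral_mono fun x => egauge_le_one ℝ (subset_closedAbsConvexHull (mem_range_self x))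
    _ < ∞ := by simp
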